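/- **Conventions.** A noncommutative probability space is a pair $(\mathcal A,\varphi)$ of a complex unital algebra and a linear functional with $\varphi(1)=1$. Let $G=(I,E)$ be a digraph. For $\mathbf i=(i_1,\dots,i_m)\in I^m$, let $\ker_G[\mathbf i]$ be the partition of $[m]=\{1,\dots,m\}$ into the classes of the equivalence relation: $k\sim k'$ if and only if $i_k=i_{k'}$ and $(i_\ell,i_k)\in E$ for every $\ell$ strictly between $k$ and $k'$ with $i_\ell\neq i_k$. A family $(\mathcal A_i)_{i\in I}$ of (not necessarily unital) subalgebras of $\mathcal A$ is *BMT independent* with respect to $(\varphi,G)$ if for every $m\ge 1$, all $i_1,\dots,i_m\in I$ and all $a_1\in\mathcal A_{i_1},\dots,a_m\in\mathcal A_{i_m}$, $$\varphi(a_1a_2\cdots a_m)=\prod_{B\in\ker_G[\mathbf i]}\varphi\Big(\prod^{\rightarrow}_{k\in B}a_k\Big),$$ where $\prod^{\rightarrow}_{k\in B}a_k=a_{k_1}\cdots a_{k_r}$ for $B=\{k_1<\dots<k_r\}$. **Theorem.** Let $H_1,\dots,H_N$ be complex Hilbert spaces with unit vectors $\xi_i\in H_i$ and inner products $\langle\cdot,\cdot\rangle_i$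 that are linear in the first argument, let $I_j$ be the identity of $H_j$, and let $P_j(x)=\langle x,\xi_j\rangle_j\,\xi_j$ be the orthogonal projection of $H_j$ onto $\mathbb C\xi_j$. Let $H=H_1\otimes\cdots\otimes H_N$ be the Hilbert space tensor product, $\xi=\xi_1\otimes\cdots\otimes\xi_N$, and $\varphi(T)=\langle T\xi,\xi\rangle$ for $T\in B(H)$. Let $G_N=([N],E_N)$ be a digraph on $[N]=\{1,\dots,N\}$, and for $i\in[N]$ let $\pi_i:B(H_i)\to B(H)$ be the $*$-homomorphism $$\pi_i(A)=P_{i,1}\otimes\cdots\otimes P_{i,i-1}\otimes A\otimes P_{i,i+1}\otimes\cdots\otimes P_{i,N},$$ where, for $j\ne i$, $P_{i,j}=I_j$ if $(i,j)\in E_N$ and $P_{i,j}=P_j$ if $(i,j)\notin E_N$. Then the family of $*$-subalgebras $\{\pi_i(B(H_i))\}_{i=1}^N$ is BMT independent in $(B(H),\varphi)$ with respect to $G_N$. -/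

import Mathlib

open scoped TensorProduct InnerProductSpace

/-! ### Noncommutative probability and BMT independence -/

/-- A noncommutative probability space structure on a complex unital algebra `𝒜`:
a linear functional `φ` with `φ 1 = 1`. -/
structure NCProbSpace (𝒜 : Type*) [Ring 𝒜] [Algebra ℂ 𝒜] where
  φ : 𝒜 →ₗ[ℂ] ℂ
  map_one : φ 1 = 1

/-- `ker_G[i]`, the kernel of `i : S → V` subordinated to the digraph `G`, as an equivalence
relation on the ordered set `S`. -/
def Digraph.kerSubordinated {S V : Type*} [LinearOrder S] (G : Digraph V) (i : S → V) :
    Setoid S where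
  r k k' := i k = i k' ∧
    ∀ l : S, i k ≠ i l → (k < l ∧ l < k' ∨ k' < l ∧ l < k) → G.Adj (i l) (i k)
  iseqv :=
    { refl := fun k => ⟨rfl, fun l _ h => by
        rcases h with h | h <;> exact absurd (h.1.trans h.2) (lt_irrefl _)⟩
      symm := fun {k k'} h => ⟨h.1.symm, fun l hl h' => by
        rw [← h.1] at hl ⊢
        exact h.2 l hl h'.symm⟩
      trans := fun {k k' k''} h h' => ⟨h.1.trans h'.1, fun l hl hb => by
        have hk' : l ≠ k' := fun e => hl (e ▸ h.1)
        have h2 : (k' < l ∧ l < k'' ∨ k'' < l ∧ l < k') → G.Adj (i l) (i k) := fun hh => by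
          rw [h.1]
          exact h'.2 l (h.1 ▸ hl) hh
        rcases lt_or_gt_of_ne hk' with hlt | hgt
        · rcases hb with hb | hb
          · exact h.2 l hl (Or.inl ⟨hb.1, hlt⟩)
          · exact h2 (Or.inr ⟨hb.1, hlt⟩)
        · rcases hb with hb | hb
          · exact h2 (Or.inl ⟨hgt, hb.2⟩)
          · exact h.2 l hl (Or.inr ⟨hgt, hb.2⟩)⟩ }

open scoped Classical in
/-- The blocks of `ker_G[i]` for `i : [m] → V`. -/
noncomputable def Digraph.kerBlocks {V : Type*} (G : Digraph V) {m : ℕ} (i : Fin m → V) :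
    Finset (Finset (Fin m)) :=
  (Finpartition.ofSetoid (G.kerSubordinated i)).parts

/-- `(a_k)|_B = a_{k_1} ⋯ a_{k_r}` for `B = {k_1 < ⋯ < k_r}`. -/
def orderedProd {𝒜 : Type*} [Monoid 𝒜] {m : ℕ} (a : Fin m → 𝒜) (B : Finset (Fin m)) : 𝒜 :=
  ((B.sort (· ≤ ·)).map a).prod

/-- BMT independence of a family of (not necessarily unital) subalgebras. -/
def BMTIndependent {𝒜 I : Type*} [Ring 𝒜] [Algebra ℂ 𝒜] (P : NCProbSpace 𝒜) (G : Digraph I)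
    (S : I → NonUnitalSubalgebra ℂ 𝒜) : Prop :=
  ∀ (m : ℕ), 1 ≤ m → ∀ (i : Fin m → I) (a : Fin m → 𝒜), (∀ k, a k ∈ S (i k)) →
    P.φ (List.ofFn a).prod = ∏ B ∈ G.kerBlocks i, P.φ (orderedProd a B)

/-- The vector state `T ↦ ⟨T ξ, ξ⟩` of a unit vector `ξ`. (Mathlib's inner product is conjugate
linear in its first argument.) -/
noncomputable def vectorState {E : Type*} [NormedAddCommGroup E] [InnerProductSpace ℂ E]
    (ξ : E) (hξ : ‖ξ‖ = 1) : NCProbSpace (E →L[ℂ] E) where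
  φ :=
    { toFun := fun T => ⟪ξ, T ξ⟫_ℂ
      map_add' := fun T T' => by simp
      map_smul' := fun c T => by simp }
  map_one := by simp [hξ]

/-! ### The Hilbert space tensor product of a finite family -/

namespace HilbertTensor

section PosSemidef

open scoped ComplexOrder

lemma sum_inner_eq {n E : Type*} [SeminormedAddCommGroup E] [InnerProductSpace ℂ E]
    (v : n → E) (x : n →₀ ℂ) :
    (x.sum fun i xi => x.sum fun j xj => star xi * ⟪v i, v j⟫_ℂ * xj) =
      ((‖x.sum fun i xi => xi • v i‖ ^ 2 : ℝ) : ℂ) := by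
  have h : ((‖x.sum fun i xi => xi • v i‖ ^ 2 : ℝ) : ℂ) =
      ⟪x.sum fun i xi => xi • v i, x.sum fun i xi => xi • v i⟫_ℂ := by
    rw [inner_self_eq_norm_sq_to_K, Complex.ofReal_pow]
    rfl
  rw [h]
  simp only [Finsupp.sum, sum_inner, inner_sum, inner_smul_left, inner_smul_right]
  simp only [Finset.mul_sum]
  rw [Finset.sum_comm]
  refine Finset.sum_congr rfl fun i _ => Finset.sum_congr rfl fun j _ => ?_
  simp only [Complex.star_def]
  ring

lemma posSemidef_inner {n E : Type*} [SeminormedAddCommGroup E] [InnerProductSpace ℂ E]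
    (v : n → E) : (Matrix.of fun a b => ⟪v a, v b⟫_ℂ).PosSemidef := by
  refine ⟨?_, fun x => ?_⟩
  · ext a b
    simp
  · simp only [Matrix.of_apply]
    rw [sum_inner_eq]
    exact Complex.zero_le_real.2 (sq_nonneg _)

lemma posSemidef_sub {n E : Type*} [SeminormedAddCommGroup E] [InnerProductSpace ℂ E]
    (A : E →L[ℂ] E) (v : n → E) :
    ((Matrix.of fun a b => (‖A‖ : ℂ) ^ 2 * ⟪v a, v b⟫_ℂ) -
      Matrix.of fun a b => ⟪A (v a), A (v b)⟫_ℂ).PosSemidef := by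
  refine ⟨?_, fun x => ?_⟩
  · ext a b
    simp
  · have h1 := sum_inner_eq v x
    have h2 := sum_inner_eq (fun a => A (v a)) x
    have h3 : (x.sum fun i xi => xi • A (v i)) = A (x.sum fun i xi => xi • v i) := by
      simp [Finsupp.sum]
    rw [h3] at h2
    have h4 : (x.sum fun i xi => x.sum fun j xj =>
        star xi * ((‖A‖ : ℂ) ^ 2 * ⟪v i, v j⟫_ℂ) * xj) =
        (‖A‖ : ℂ) ^ 2 * ((‖x.sum fun i xi => xi • v i‖ ^ 2 : ℝ) : ℂ) := by
      rw [← h1]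
      simp only [Finsupp.sum, Finset.mul_sum]
      refine Finset.sum_congr rfl fun i _ => Finset.sum_congr rfl fun j _ => ?_
      ring
    simp only [Matrix.sub_apply, Matrix.of_apply, mul_sub, sub_mul, Finsupp.sum_sub]
    rw [h2, h4, sub_nonneg, ← Complex.ofReal_pow, ← Complex.ofReal_mul, Complex.real_le_real,
      ← mul_pow]
    exact pow_le_pow_left₀ (norm_nonneg _) (A.le_opNorm _) 2

lemma posSemidef_prod {n ι : Type*} (F G : ι → Matrix n n ℂ) (hF : ∀ i, (F i).PosSemidef)
    (hG : ∀ i, (G i - F i).PosSemidef) (s : Finset ι) :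
    (Matrix.of fun a b => ∏ i ∈ s, F i a b).PosSemidef ∧
    (Matrix.of fun a b => ∏ i ∈ s, G i a b - ∏ i ∈ s, F i a b).PosSemidef := by
  classical
  induction s using Finset.induction_on with
  | empty =>
    constructor
    · simpa using posSemidef_inner (fun _ : n => (1 : ℂ))
    · convert (Matrix.PosSemidef.zero (R := ℂ) (n := n)) using 1
      ext a b
      simp
  | insert j s hj ih =>
    have hGj : (G j).PosSemidef := by simpa using (hG j).add (hF j)
    constructor
    · have h := (hF j).hadamard ih.1
      refine (congrArg Matrix.PosSemidef ?_).mp h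
      ext a b
      simp [Finset.prod_insert hj]
    · have h := (hGj.hadamard ih.2).add ((hG j).hadamard ih.1)
      refine (congrArg Matrix.PosSemidef ?_).mp h
      ext a b
      simp [Finset.prod_insert hj]
      ring

end PosSemidef

/-- The algebraic tensor product, as a separate type: it carries the norm of the inner product
below, while Mathlib equips `⨂[ℂ] i, H i` with the projective norm. -/
def Alg {ι : Type*} (H : ι → Type*) [∀ i, NormedAddCommGroup (H i)]
    [∀ i, InnerProductSpace ℂ (H i)] : Type _ :=
  ⨂[ℂ] i, H i

variable {ι : Type*} {H : ι → Type*} [∀ i, NormedAddCommGroup (H i)]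
    [∀ i, InnerProductSpace ℂ (H i)]

noncomputable instance : AddCommGroup (Alg H) := inferInstanceAs (AddCommGroup (⨂[ℂ] i, H i))

noncomputable instance : Module ℂ (Alg H) := inferInstanceAs (Module ℂ (⨂[ℂ] i, H i))

/-- Pure tensors in the algebraic tensor product. -/
noncomputable def algTprod (x : ∀ i, H i) : Alg H := PiTensorProduct.tprod ℂ x

lemma alg_induction {p : Alg H → Prop} (smul_tprod : ∀ (c : ℂ) x, p (c • algTprod x))
    (add : ∀ x y, p x → p y → p (x + y)) (z : Alg H) : p z :=
  PiTensorProduct.induction_on z smul_tprod add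

/-- The linear map on the algebraic tensor product induced by a multilinear map. -/
noncomputable def algLift {E : Type*} [AddCommGroup E] [Module ℂ E] (f : MultilinearMap ℂ H E) :
    Alg H →ₗ[ℂ] E :=
  PiTensorProduct.lift f

@[simp] lemma algLift_algTprod {E : Type*} [AddCommGroup E] [Module ℂ E]
    (f : MultilinearMap ℂ H E) (x : ∀ i, H i) : algLift f (algTprod x) = f x :=
  PiTensorProduct.lift.tprod x

/-- The algebraic tensor product of a family of linear operators. -/
noncomputable def algMap (A : ∀ i, H i →ₗ[ℂ] H i) : Alg H →ₗ[ℂ] Alg H := PiTensorProduct.map A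

@[simp] lemma algMap_algTprod (A : ∀ i, H i →ₗ[ℂ] H i) (x : ∀ i, H i) :
    algMap A (algTprod x) = algTprod fun i => A i (x i) :=
  PiTensorProduct.map_tprod A x

lemma algMap_id (z : Alg H) : algMap (fun i => (LinearMap.id : H i →ₗ[ℂ] H i)) z = z :=
  LinearMap.congr_fun PiTensorProduct.map_id z

lemma exists_finsupp (z : Alg H) :
    ∃ f : (∀ i, H i) →₀ ℂ, z = f.sum fun x c => c • algTprod x := by
  classical
  induction z using alg_induction with
  | smul_tprod c x => exact ⟨Finsupp.single x c, by simp⟩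
  | add x y hx hy =>
    obtain ⟨f, rfl⟩ := hx
    obtain ⟨g, rfl⟩ := hy
    refine ⟨f + g, ?_⟩
    rw [Finsupp.sum_add_index] <;> simp [add_smul]

variable [Fintype ι]

/-- The multilinear map `y ↦ ∏ i, ⟪x i, y i⟫`. -/
noncomputable def prodInner (x : ∀ i, H i) : MultilinearMap ℂ H ℂ :=
  (MultilinearMap.mkPiAlgebra ℂ ι ℂ).compLinearMap
    fun i => ((innerSL ℂ (x i) : H i →L[ℂ] ℂ) : H i →ₗ[ℂ] ℂ)

@[simp] lemma prodInner_apply (x y : ∀ i, H i) : prodInner x y = ∏ i, ⟪x i, y i⟫_ℂ := by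
  simp [prodInner]

lemma prodInner_symm (x y : ∀ i, H i) : prodInner x y = star (prodInner y x) := by
  simp

/-- The linear form on the algebraic tensor product with values `∏ i, ⟪x i, y i⟫`. -/
noncomputable def pairing (x : ∀ i, H i) : Alg H →ₗ[ℂ] ℂ := algLift (prodInner x)

lemma pairing_algTprod (x y : ∀ i, H i) : pairing x (algTprod y) = prodInner x y :=
  algLift_algTprod _ y

/-- The sesquilinear form with value `∏ i, ⟪y i, x i⟫` at pure tensors `x`, `y`: linear in the
first and conjugate linear in the second argument. -/
noncomputable def form : Alg H →ₗ[ℂ] Alg H →ₗ⋆[ℂ] ℂ :=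
  algLift
    { toFun := fun x =>
        { toFun := fun w => star (pairing x w)
          map_add' := fun w w' => by rw [map_add, star_add]
          map_smul' := fun c w => by simp }
      map_update_add' := fun x i u v => by
        ext w
        induction w using alg_induction with
        | smul_tprod c y =>
          simp only [LinearMap.coe_mk, AddHom.coe_mk, LinearMap.add_apply, map_smul,
            pairing_algTprod, ← prodInner_symm, star_smul, MultilinearMap.map_update_add, smul_add]
        | add y z hy hz => rw [map_add, map_add, hy, hz]
      map_update_smul' := fun x i d u => by
        ext w
        induction w using alg_induction with
        | smul_tprod c y =>
          simp only [LinearMap.coe_mk, AddHom.coe_mk, LinearMap.smul_apply, map_smul,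
            pairing_algTprod, ← prodInner_symm, star_smul, MultilinearMap.map_update_smul]
          exact smul_comm _ _ _
        | add y z hy hz => rw [map_add, map_add, hy, hz] }

@[simp] lemma form_algTprod (x y : ∀ i, H i) :
    form (algTprod x) (algTprod y) = ∏ i, ⟪y i, x i⟫_ℂ := by
  have h : form (algTprod x) (algTprod y) = star (pairing x (algTprod y)) := by
    rw [form, algLift_algTprod]
    rfl
  rw [h, pairing_algTprod, ← prodInner_symm, prodInner_apply]

lemma form_symm (x y : Alg H) : star (form x y) = form y x := by
  induction x using alg_induction with
  | smul_tprod c x =>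
    induction y using alg_induction with
    | smul_tprod d y => simp; ring
    | add y z hy hz => rw [map_add, star_add, hy, hz, map_add, LinearMap.add_apply]
  | add y z hy hz => rw [map_add, LinearMap.add_apply, star_add, hy, hz, map_add]

lemma form_map_self (A : ∀ i, H i →ₗ[ℂ] H i) (f : (∀ i, H i) →₀ ℂ) :
    form (algMap A (f.sum fun x c => c • algTprod x))
      (algMap A (f.sum fun x c => c • algTprod x)) =
    f.sum fun x c => f.sum fun y d => star c * (∏ i, ⟪A i (x i), A i (y i)⟫_ℂ) * d := by
  simp only [Finsupp.sum, map_sum, LinearMap.sum_apply, map_smul, algMap_algTprod,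
    LinearMap.map_smulₛₗ, LinearMap.smul_apply, form_algTprod, smul_eq_mul]
  simp only [Finset.mul_sum]
  refine Finset.sum_congr rfl fun x _ => Finset.sum_congr rfl fun y _ => ?_
  rw [Complex.star_def]
  ring

open scoped ComplexOrder in
lemma form_self_nonneg (z : Alg H) : 0 ≤ (form z z).re := by
  obtain ⟨f, rfl⟩ := exists_finsupp z
  have h := form_map_self (fun i => (LinearMap.id : H i →ₗ[ℂ] H i)) f
  rw [algMap_id] at h
  rw [h]
  exact (Complex.le_def.1 ((posSemidef_prod
    (fun i => Matrix.of fun x y : (∀ i, H i) => ⟪x i, y i⟫_ℂ) _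
    (fun i => posSemidef_inner fun x : (∀ i, H i) => x i)
    (fun i => by rw [sub_self]; exact Matrix.PosSemidef.zero) Finset.univ).1.2 f)).1

/-- The inner product on the algebraic tensor product. -/
@[reducible]
noncomputable def core : PreInnerProductSpace.Core ℂ (Alg H) where
  inner x y := form y x
  conj_inner_symm x y := form_symm x y
  re_inner_nonneg x := form_self_nonneg x
  add_left x y z := map_add _ _ _
  smul_left x y r := by simp

noncomputable instance : SeminormedAddCommGroup (Alg H) :=
  @InnerProductSpace.Core.toSeminormedAddCommGroup ℂ (Alg H) _ _ _ core

noncomputable instance : InnerProductSpace ℂ (Alg H) := InnerProductSpace.ofCore core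

lemma inner_eq_form (x y : Alg H) : ⟪x, y⟫_ℂ = form y x := rfl

@[simp] lemma inner_algTprod (x y : ∀ i, H i) :
    ⟪algTprod x, algTprod y⟫_ℂ = ∏ i, ⟪x i, y i⟫_ℂ := by
  rw [inner_eq_form, form_algTprod]

open scoped ComplexOrder in
lemma norm_algMap_le (A : ∀ i, H i →L[ℂ] H i) (z : Alg H) :
    ‖algMap (fun i => (A i : H i →ₗ[ℂ] H i)) z‖ ≤ (∏ i, ‖A i‖) * ‖z‖ := by
  refine le_of_sq_le_sq ?_ (by positivity)
  obtain ⟨f, rfl⟩ := exists_finsupp z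
  have hsq : ∀ w : Alg H, ‖w‖ ^ 2 = (form w w).re := fun w => by
    rw [← inner_eq_form, ← inner_self_eq_norm_sq (𝕜 := ℂ)]
    rfl
  have h1 := form_map_self (fun i => (A i : H i →ₗ[ℂ] H i)) f
  have h2 := form_map_self (fun i => (LinearMap.id : H i →ₗ[ℂ] H i)) f
  rw [algMap_id] at h2
  rw [mul_pow, hsq, hsq, h1, h2]
  have h3 := (posSemidef_prod
    (fun i => Matrix.of fun x y : (∀ i, H i) => ⟪A i (x i), A i (y i)⟫_ℂ)
    (fun i => Matrix.of fun x y : (∀ i, H i) => (‖A i‖ : ℂ) ^ 2 * ⟪x i, y i⟫_ℂ)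
    (fun i => posSemidef_inner fun x : (∀ i, H i) => A i (x i))
    (fun i => posSemidef_sub (A i) fun x : (∀ i, H i) => x i) Finset.univ).2.2 f
  have h4 := (Complex.le_def.1 h3).1
  simp only [Matrix.of_apply, Finset.prod_mul_distrib, mul_sub, sub_mul, Finsupp.sum_sub,
    Complex.sub_re, Complex.zero_re, sub_nonneg] at h4
  refine h4.trans (le_of_eq ?_)
  have hc : ((∏ i, ‖A i‖) ^ 2 : ℝ) * (f.sum fun x c => f.sum fun y d =>
      star c * (∏ i, ⟪x i, y i⟫_ℂ) * d).re = ((((∏ i, ‖A i‖) ^ 2 : ℝ) : ℂ) *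
      (f.sum fun x c => f.sum fun y d => star c * (∏ i, ⟪x i, y i⟫_ℂ) * d)).re := by
    rw [Complex.re_ofReal_mul]
  refine Eq.trans ?_ hc.symm
  congr 1
  simp only [Finsupp.sum, Finset.mul_sum]
  refine Finset.sum_congr rfl fun x _ => Finset.sum_congr rfl fun y _ => ?_
  rw [Finset.prod_pow]
  push_cast
  ring

/-- `A_1 ⊗ ⋯ ⊗ A_N` on the algebraic tensor product. -/
noncomputable def algOp (A : ∀ i, H i →L[ℂ] H i) : Alg H →L[ℂ] Alg H :=
  (algMap fun i => (A i : H i →ₗ[ℂ] H i)).mkContinuous (∏ i, ‖A i‖) (norm_algMap_le A)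

@[simp] lemma algOp_algTprod (A : ∀ i, H i →L[ℂ] H i) (x : ∀ i, H i) :
    algOp A (algTprod x) = algTprod fun i => A i (x i) :=
  algMap_algTprod _ x

lemma inner_algOp (A B : ∀ i, H i →L[ℂ] H i) (h : ∀ i x y, ⟪A i x, y⟫_ℂ = ⟪x, B i y⟫_ℂ)
    (x y : Alg H) : ⟪algOp A x, y⟫_ℂ = ⟪x, algOp B y⟫_ℂ := by
  induction x using alg_induction with
  | smul_tprod c x =>
    induction y using alg_induction with
    | smul_tprod d y => simp [inner_smul_left, inner_smul_right, h]
    | add y z hy hz => rw [map_add, inner_add_right, inner_add_right, hy, hz]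
  | add y z hy hz => rw [map_add, inner_add_left, inner_add_left, hy, hz]

end HilbertTensor

section

variable {ι : Type*} [Fintype ι]

/-- The Hilbert space tensor product of the family `H`: the (Hausdorff) completion of the algebraic
tensor product for `⟪x₁ ⊗ ⋯ ⊗ x_N, y₁ ⊗ ⋯ ⊗ y_N⟫ = ∏ i, ⟪x i, y i⟫`. -/
abbrev HilbertTensor (H : ι → Type*) [∀ i, NormedAddCommGroup (H i)]
    [∀ i, InnerProductSpace ℂ (H i)] : Type _ :=
  UniformSpace.Completion (HilbertTensor.Alg H)

namespace HilbertTensor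

variable {H : ι → Type*} [∀ i, NormedAddCommGroup (H i)] [∀ i, InnerProductSpace ℂ (H i)]

/-- The pure tensor `x₁ ⊗ ⋯ ⊗ x_N`. -/
noncomputable def tprod (x : ∀ i, H i) : HilbertTensor H := (algTprod x : Alg H)

@[simp] lemma inner_tprod (x y : ∀ i, H i) : ⟪tprod x, tprod y⟫_ℂ = ∏ i, ⟪x i, y i⟫_ℂ := by
  rw [tprod, tprod, UniformSpace.Completion.inner_coe, inner_algTprod]

lemma norm_tprod_eq_one {x : ∀ i, H i} (hx : ∀ i, ‖x i‖ = 1) : ‖tprod x‖ = 1 := by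
  have h : ⟪tprod x, tprod x⟫_ℂ = 1 := by
    rw [inner_tprod]
    exact Finset.prod_eq_one fun i _ => by rw [inner_self_eq_norm_sq_to_K, hx i]; simp
  rw [norm_eq_sqrt_re_inner (𝕜 := ℂ), h]
  simp

/-- The bounded operator `A_1 ⊗ ⋯ ⊗ A_N` on the Hilbert space tensor product. -/
noncomputable def op (A : ∀ i, H i →L[ℂ] H i) : HilbertTensor H →L[ℂ] HilbertTensor H :=
  (algOp A).completion

@[simp] lemma op_tprod (A : ∀ i, H i →L[ℂ] H i) (x : ∀ i, H i) :
    op A (tprod x) = tprod fun i => A i (x i) := by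
  simp [op, tprod]

lemma ext_tprod {S T : HilbertTensor H →L[ℂ] HilbertTensor H}
    (h : ∀ x, S (tprod x) = T (tprod x)) : S = T := by
  ext z
  induction z using UniformSpace.Completion.induction_on with
  | hp => exact isClosed_eq S.continuous T.continuous
  | ih z =>
    induction z using alg_induction with
    | smul_tprod c x =>
      rw [UniformSpace.Completion.coe_smul, map_smul, map_smul]
      exact congrArg (c • ·) (h x)
    | add x y hx hy => rw [UniformSpace.Completion.coe_add, map_add, map_add, hx, hy]

lemma op_mul (A B : ∀ i, H i →L[ℂ] H i) : op (fun i => A i * B i) = op A * op B :=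
  ext_tprod fun x => by simp

lemma star_op [∀ i, CompleteSpace (H i)] (A : ∀ i, H i →L[ℂ] H i) :
    op (fun i => star (A i)) = star (op A) := by
  rw [ContinuousLinearMap.star_eq_adjoint, ContinuousLinearMap.eq_adjoint_iff]
  intro x y
  induction x, y using UniformSpace.Completion.induction_on₂ with
  | hp => exact isClosed_eq (by fun_prop) (by fun_prop)
  | ih x y =>
    rw [op, op, ContinuousLinearMap.completion_apply_coe,
      ContinuousLinearMap.completion_apply_coe, UniformSpace.Completion.inner_coe,
      UniformSpace.Completion.inner_coe]
    exact inner_algOp _ _ (fun i x y => ContinuousLinearMap.adjoint_inner_left _ _ _) x y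

open Function in
lemma tprod_update_add [DecidableEq ι] (x : ∀ i, H i) (i : ι) (u v : H i) :
    tprod (update x i (u + v)) = tprod (update x i u) + tprod (update x i v) := by
  rw [tprod, tprod, tprod, ← UniformSpace.Completion.coe_add]
  exact congrArg _ ((PiTensorProduct.tprod ℂ).map_update_add x i u v)

open Function in
lemma tprod_update_smul [DecidableEq ι] (x : ∀ i, H i) (i : ι) (c : ℂ) (u : H i) :
    tprod (update x i (c • u)) = c • tprod (update x i u) := by
  rw [tprod, tprod, ← UniformSpace.Completion.coe_smul]
  exact congrArg _ ((PiTensorProduct.tprod ℂ).map_update_smul x i c u)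

open Function in
lemma op_update_tprod [DecidableEq ι] (A : ∀ i, H i →L[ℂ] H i) (i : ι) (u : H i →L[ℂ] H i)
    (x : ∀ i, H i) :
    op (update A i u) (tprod x) = tprod (update (fun j => A j (x j)) i (u (x i))) := by
  rw [op_tprod]
  congr 1
  ext j
  exact apply_update (fun j (F : H j →L[ℂ] H j) => F (x j)) A i u j

end HilbertTensor

/-! ### The representations `π_i` -/

section Representation

variable {H : ι → Type*} [∀ i, NormedAddCommGroup (H i)] [∀ i, InnerProductSpace ℂ (H i)]

open scoped Classical in
/-- `P_{i,j}`: the identity of `H j` if `(i, j)` is an edge of `G`, and otherwise the rank-one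
operator `x ↦ ⟨x, ξ j⟩ ξ j`. -/
noncomputable def slotOperator (G : Digraph ι) (ξ : ∀ i, H i) (i j : ι) : H j →L[ℂ] H j :=
  if G.Adj i j then 1 else InnerProductSpace.rankOne ℂ (ξ j) (ξ j)

open scoped Classical in
/-- `P_{i,1} ⊗ ⋯ ⊗ A ⊗ ⋯ ⊗ P_{i,N}`, with `A` in slot `i`. -/
noncomputable def slotTensor (G : Digraph ι) (ξ : ∀ i, H i) (i : ι) (A : H i →L[ℂ] H i) :
    HilbertTensor H →L[ℂ] HilbertTensor H :=
  HilbertTensor.op (Function.update (slotOperator G ξ i) i A)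

variable [∀ i, CompleteSpace (H i)]

/-- The `*`-homomorphism `π_i : B(H_i) → B(H)`. -/
noncomputable def bmtRep (G : Digraph ι) (ξ : ∀ i, H i) (hξ : ∀ i, ‖ξ i‖ = 1) (i : ι) :
    (H i →L[ℂ] H i) →⋆ₙₐ[ℂ] (HilbertTensor H →L[ℂ] HilbertTensor H) where
  toFun A := slotTensor G ξ i A
  map_smul' c A := by
    classical
    refine HilbertTensor.ext_tprod fun x => ?_
    simp only [slotTensor, _root_.smul_apply, HilbertTensor.op_update_tprod]
    exact HilbertTensor.tprod_update_smul _ _ _ _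
  map_zero' := by
    classical
    refine HilbertTensor.ext_tprod fun x => ?_
    simp only [slotTensor, _root_.zero_apply, HilbertTensor.op_update_tprod]
    simpa only [zero_smul] using HilbertTensor.tprod_update_smul
      (fun j => slotOperator G ξ i j (x j)) i 0 0
  map_add' A B := by
    classical
    refine HilbertTensor.ext_tprod fun x => ?_
    simp only [slotTensor, _root_.add_apply, HilbertTensor.op_update_tprod]
    exact HilbertTensor.tprod_update_add _ _ _ _
  map_mul' A B := by
    classical
    rw [slotTensor, slotTensor, slotTensor, ← HilbertTensor.op_mul]
    congr 1
    funext j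
    rcases eq_or_ne j i with rfl | h
    · simp
    · have hP : slotOperator G ξ i j * slotOperator G ξ i j = slotOperator G ξ i j := by
        unfold slotOperator
        split_ifs
        · simp
        · exact InnerProductSpace.isIdempotentElem_rankOne_self (hξ j)
      simp [h, hP]
  map_star' A := by
    classical
    change slotTensor G ξ i (star A) = star (slotTensor G ξ i A)
    rw [slotTensor, slotTensor, ← HilbertTensor.star_op]
    congr 1
    funext j
    rcases eq_or_ne j i with rfl | h
    · simp
    · have hP : star (slotOperator G ξ i j) = slotOperator G ξ i j := by
        unfold slotOperator
        split_ifs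
        · simp
        · simp [ContinuousLinearMap.star_eq_adjoint]
      simp [h, hP]

end Representation

end

/-! ### Ordered products and the count of later positions. -/

section BlockFactorization

open scoped Classical

/-! Pure tensors factor the state: for tensor operators, the vacuum expectation of a word is the
product over slots `j` of one-slot expectations at `ξ j` (`inner_orderedProd_op`). In slot `j`, a
position acts by its own operator if its letter is `j`, by the identity if its letter has an edge to
`j`, and otherwise by the projection onto `ξ j`. These projections cut the slot word into segments,
and its expectation is the product of the expectations of the segments
(`inner_orderedProd_eq_prod`). Two positions with letter `j` lie in one segment exactly when they
are equivalent for `ker_G` (`kerSubordinated_iff`), so the nonempty segments over all slots are the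
blocks of the kernel (`prod_kerBlocks`). Conversely, in the word of a single block with letter `j`,
every other slot sees only identities and projections, which fix the vacuum. The state of the block
is therefore the expectation of its segment. Segments are labelled by the number of projections to
their right, since the rightmost operator acts first. -/

lemma orderedProd_univ {M : Type*} [Monoid M] {m : ℕ} (a : Fin m → M) :
    orderedProd a Finset.univ = (List.ofFn a).prod := by
  rw [orderedProd, Fin.sort_univ, List.ofFn_eq_map]

@[simp] lemma orderedProd_empty {M : Type*} [Monoid M] {m : ℕ} (a : Fin m → M) :
    orderedProd a ∅ = 1 := by
  simp [orderedProd]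

lemma orderedProd_insert {M : Type*} [Monoid M] {m : ℕ} (a : Fin m → M) {x : Fin m}
    {U : Finset (Fin m)} (h : ∀ y ∈ U, x < y) :
    orderedProd a (insert x U) = a x * orderedProd a U := by
  rw [orderedProd, Finset.sort_insert (· ≤ ·) (fun y hy => (h y hy).le)
    (fun hx => lt_irrefl _ (h x hx)), List.map_cons, List.prod_cons, orderedProd]

lemma map_orderedProd {M M' : Type*} [Monoid M] [Monoid M'] (f : M →* M') {m : ℕ}
    (a : Fin m → M) (U : Finset (Fin m)) :
    f (orderedProd a U) = orderedProd (fun k => f (a k)) U := by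
  rw [orderedProd, orderedProd, map_list_prod, List.map_map]
  rfl

lemma orderedProd_apply_eq_self {E : Type*} [NormedAddCommGroup E] [InnerProductSpace ℂ E]
    {m : ℕ} (b : Fin m → E →L[ℂ] E) (v : E) (U : Finset (Fin m)) (h : ∀ k ∈ U, b k v = v) :
    orderedProd b U v = v := by
  induction U using Finset.induction_on_min with
  | empty => simp
  | insert x U hx ih =>
    rw [orderedProd_insert b hx, mul_apply_eq_comp,
      ih fun k hk => h k (Finset.mem_insert_of_mem hk), h x (Finset.mem_insert_self _ _)]

/-- The number of positions after `k` at which `p` holds. -/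
noncomputable def countAfter {m : ℕ} (p : Fin m → Prop) (k : Fin m) : ℕ :=
  (Finset.univ.filter fun l => k < l ∧ p l).card

lemma countAfter_le {m : ℕ} (p : Fin m → Prop) (k : Fin m) : countAfter p k ≤ m :=
  (Finset.card_le_univ _).trans (Fintype.card_fin m).le

/-- The two counted sets are nested, so equal cardinality forces them to coincide. The interval is
half-open because `countAfter` excludes its own position. -/
lemma countAfter_eq_iff {m : ℕ} (p : Fin m → Prop) {k k' : Fin m} (h : k ≤ k') :
    countAfter p k = countAfter p k' ↔ ∀ l, k < l → l ≤ k' → ¬ p l := by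
  have hsub : (Finset.univ.filter fun l => k' < l ∧ p l) ⊆
      Finset.univ.filter fun l => k < l ∧ p l := fun l hl => by
    simp only [Finset.mem_filter, Finset.mem_univ, true_and] at hl ⊢
    exact ⟨h.trans_lt hl.1, hl.2⟩
  constructor
  · intro hc l hl hl' hp
    have he := Finset.eq_of_subset_of_card_le hsub hc.le
    have hmem : l ∈ Finset.univ.filter fun l => k' < l ∧ p l := by
      rw [he]
      simp [hl, hp]
    exact absurd hl' (not_le.2 (Finset.mem_filter.1 hmem).2.1)
  · intro hl
    refine congrArg Finset.card (Finset.Subset.antisymm (fun l hm => ?_) hsub)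
    simp only [Finset.mem_filter, Finset.mem_univ, true_and] at hm ⊢
    exact ⟨not_le.1 fun hle => hl l hm.1 hle hm.2, hm.2⟩

/-! ### Factorization in one slot. -/

section OneSlot

variable {E : Type*} [NormedAddCommGroup E] [InnerProductSpace ℂ E]

/-- Operators are adjoined on the left. The vector is always a scalar, collected from the closed
segments, times the still open segment applied to `ξ`; a projection closes that segment into one
more scalar and restores `ξ`. An upper set is needed because `countAfter` looks at all later
positions, which must already be in `U`. -/
lemma orderedProd_apply_of_isUpperSet (ξ : E) {m : ℕ} (b : Fin m → E →L[ℂ] E)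
    (p q : Fin m → Prop) (hp : ∀ k, p k → b k = InnerProductSpace.rankOne ℂ ξ ξ)
    (hpq : ∀ k, q k → ¬ p k) (h1 : ∀ k, ¬ p k → ¬ q k → b k = 1)
    (U : Finset (Fin m)) (hU : IsUpperSet (U : Set (Fin m))) :
    orderedProd b U ξ =
      (∏ s ∈ Finset.range (U.filter p).card,
        ⟪ξ, orderedProd b (U.filter fun k => q k ∧ countAfter p k = s) ξ⟫_ℂ) •
      orderedProd b (U.filter fun k => q k ∧ countAfter p k = (U.filter p).card) ξ := by
  induction U using Finset.induction_on_min with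
  | empty => simp
  | insert x U hx ih =>
    have hxU : x ∉ U := fun h => lt_irrefl _ (hx x h)
    have hU' : IsUpperSet (U : Set (Fin m)) := fun y z hyz hy => by
      have hz := hU hyz (Finset.mem_coe.2 (Finset.mem_insert_of_mem hy))
      exact (Finset.mem_insert.1 hz).resolve_left ((hx y hy).trans_le hyz).ne'
    have hcx : countAfter p x = (U.filter p).card := by
      refine congrArg Finset.card (Finset.ext fun l => ?_)
      simp only [Finset.mem_filter, Finset.mem_univ, true_and]
      refine and_congr_left fun _ => ⟨fun hl => ?_, hx l⟩
      have hz := hU hl.le (Finset.mem_coe.2 (Finset.mem_insert_self x U))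
      exact (Finset.mem_insert.1 hz).resolve_left hl.ne'
    rw [orderedProd_insert b hx, mul_apply_eq_comp, ih hU', map_smul]
    by_cases hpx : p x
    · have hq : ¬ q x := fun h => hpq x h hpx
      have hcard : ((insert x U).filter p).card = (U.filter p).card + 1 := by
        rw [Finset.filter_insert, if_pos hpx, Finset.card_insert_of_notMem (by simp [hxU])]
      -- The segment opened by the projection at `x` is still empty: no position of `U` has more
      -- projections after it than `U` contains.
      have hlast : (U.filter fun k => q k ∧ countAfter p k = (U.filter p).card + 1) = ∅ := by
        refine Finset.filter_eq_empty_iff.2 fun k hk hc => ?_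
        have hle : countAfter p k ≤ (U.filter p).card := Finset.card_le_card fun l hl => by
          simp only [Finset.mem_filter, Finset.mem_univ, true_and] at hl ⊢
          exact ⟨hU' hl.1.le hk, hl.2⟩
        omega
      have hins : ∀ s, ((insert x U).filter fun k => q k ∧ countAfter p k = s) =
          U.filter fun k => q k ∧ countAfter p k = s := fun s => by
        rw [Finset.filter_insert, if_neg fun h => hq h.1]
      rw [hcard]
      simp only [hins]
      rw [hlast, Finset.prod_range_succ, hp x hpx, InnerProductSpace.rankOne_apply, mul_smul,
        orderedProd_empty, one_apply_eq_self]
    · have hcard : (insert x U).filter p = U.filter p := by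
        rw [Finset.filter_insert, if_neg hpx]
      -- The position `x` can join only the open segment, whose label lies just outside the range of
      -- closed ones.
      have hprod : ∀ s ∈ Finset.range (U.filter p).card,
          ((insert x U).filter fun k => q k ∧ countAfter p k = s) =
            U.filter fun k => q k ∧ countAfter p k = s := fun s hs => by
        rw [Finset.filter_insert, if_neg fun h => ?_]
        rw [← hcx, h.2] at hs
        exact Finset.notMem_range_self hs
      rw [hcard]
      congr 1
      · exact Finset.prod_congr rfl fun s hs => by rw [hprod s hs]
      · by_cases hqx : q x
        · rw [Finset.filter_insert, if_pos ⟨hqx, hcx⟩,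
            orderedProd_insert b fun y hy => hx y (Finset.mem_filter.1 hy).1,
            mul_apply_eq_comp]
        · rw [Finset.filter_insert, if_neg fun h => hqx h.1, h1 x hpx hqx,
            one_apply_eq_self]

/-- The final pairing with `ξ` closes the last segment. Labels beyond the number of projections give
empty segments, each contributing `⟪ξ, ξ⟫ = 1`; the range can then be `m + 1` in every slot. -/
lemma inner_orderedProd_eq_prod (ξ : E) (hξ : ‖ξ‖ = 1) {m : ℕ} (b : Fin m → E →L[ℂ] E)
    (p q : Fin m → Prop) (hp : ∀ k, p k → b k = InnerProductSpace.rankOne ℂ ξ ξ)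
    (hpq : ∀ k, q k → ¬ p k) (h1 : ∀ k, ¬ p k → ¬ q k → b k = 1) :
    ⟪ξ, orderedProd b Finset.univ ξ⟫_ℂ =
      ∏ s ∈ Finset.range (m + 1),
        ⟪ξ, orderedProd b (Finset.univ.filter fun k => q k ∧ countAfter p k = s) ξ⟫_ℂ := by
  rw [orderedProd_apply_of_isUpperSet ξ b p q hp hpq h1 Finset.univ (by simp [isUpperSet_univ]),
    inner_smul_right, ← Finset.prod_range_succ fun s => ⟪ξ, orderedProd b
      (Finset.univ.filter fun k => q k ∧ countAfter p k = s) ξ⟫_ℂ]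
  have hle : (Finset.univ.filter p).card ≤ m :=
    (Finset.card_le_univ _).trans (Fintype.card_fin m).le
  refine Finset.prod_subset (Finset.range_mono (by omega)) fun s _ hs => ?_
  have hempty : (Finset.univ.filter fun k => q k ∧ countAfter p k = s) = ∅ := by
    refine Finset.filter_eq_empty_iff.2 fun k _ hc => hs (Finset.mem_range.2 ?_)
    have hk : countAfter p k ≤ (Finset.univ.filter p).card :=
      Finset.card_le_card (Finset.monotone_filter_right _ fun _ _ h => h.2)
    omega
  rw [hempty, orderedProd_empty, one_apply_eq_self, inner_self_eq_norm_sq_to_K, hξ]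
  simp

end OneSlot

/-! ### Kernel blocks as segments. -/

namespace Digraph

variable {V : Type*} (G : Digraph V) {m : ℕ} (i : Fin m → V)

/-- The positions of a word whose letter acts in slot `j` as the rank-one projection. -/
def Separates (j : V) (l : Fin m) : Prop := i l ≠ j ∧ ¬ G.Adj (i l) j

/-- The positions with letter `j` that are followed by exactly `s` separating positions. -/
noncomputable def slotBlock (js : V × ℕ) : Finset (Fin m) :=
  Finset.univ.filter fun k => i k = js.1 ∧ countAfter (G.Separates i js.1) k = js.2

/-- The edge condition in the kernel says that no position strictly between `k` and `k'` separates.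
The endpoint `k'` can be included, since it carries the letter `i k` and so never separates. -/
lemma kerSubordinated_iff_of_le {k k' : Fin m} (h : k ≤ k') :
    G.kerSubordinated i k k' ↔ i k' = i k ∧
      countAfter (G.Separates i (i k)) k' = countAfter (G.Separates i (i k)) k := by
  change (i k = i k' ∧ ∀ l : Fin m, i k ≠ i l →
    (k < l ∧ l < k' ∨ k' < l ∧ l < k) → G.Adj (i l) (i k)) ↔ _
  rw [eq_comm (a := i k)]
  refine and_congr_right fun hi => ?_
  rw [eq_comm (a := countAfter _ k'), countAfter_eq_iff _ h]
  constructor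
  · rintro hA l hl hl' ⟨hne, hadj⟩
    refine hadj (hA l hne.symm (Or.inl ⟨hl, lt_of_le_of_ne hl' ?_⟩))
    rintro rfl
    exact hne hi
  · rintro hS l hne (hl | hl)
    · exact not_not.1 fun hadj => hS l hl.1 hl.2.le ⟨hne.symm, hadj⟩
    · exact absurd (hl.1.trans hl.2) (not_lt.2 h)

lemma kerSubordinated_iff (k k' : Fin m) :
    G.kerSubordinated i k k' ↔ i k' = i k ∧
      countAfter (G.Separates i (i k)) k' = countAfter (G.Separates i (i k)) k := by
  rcases le_total k k' with h | h
  · exact G.kerSubordinated_iff_of_le i h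
  · rw [(G.kerSubordinated i).comm', G.kerSubordinated_iff_of_le i h]
    constructor
    all_goals
      rintro ⟨h1, h2⟩
      rw [h1] at *
      exact ⟨rfl, h2.symm⟩

lemma slotBlock_eq (k : Fin m) :
    G.slotBlock i (i k, countAfter (G.Separates i (i k)) k) =
      Finset.univ.filter (G.kerSubordinated i k) :=
  Finset.filter_congr fun k' _ => (G.kerSubordinated_iff i k k').symm

/-- Any member of a segment recovers its label, so distinct labels give distinct nonempty blocks. -/
lemma eq_of_mem_slotBlock {js : V × ℕ} {k : Fin m} (hk : k ∈ G.slotBlock i js) :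
    js = (i k, countAfter (G.Separates i (i k)) k) := by
  obtain ⟨j, s⟩ := js
  obtain ⟨rfl, hs⟩ := (Finset.mem_filter.1 hk).2
  exact congrArg _ hs.symm

lemma mem_kerBlocks_iff (B : Finset (Fin m)) :
    B ∈ G.kerBlocks i ↔ ∃ k, Finset.univ.filter (G.kerSubordinated i k) = B := by
  simp [kerBlocks, Finpartition.ofSetoid, Finpartition.ofSetSetoid]

/-- The labels form a full rectangle. Those with empty segment are harmless by `hf`, and the others
correspond bijectively to the blocks. -/
lemma prod_kerBlocks [Fintype V] {M : Type*} [CommMonoid M] (f : Finset (Fin m) → M)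
    (hf : f ∅ = 1) :
    ∏ B ∈ G.kerBlocks i, f B = ∏ j, ∏ s ∈ Finset.range (m + 1), f (G.slotBlock i (j, s)) := by
  rw [← Finset.prod_product' (f := fun j s => f (G.slotBlock i (j, s)))]
  have himage : G.kerBlocks i = ((Finset.univ ×ˢ Finset.range (m + 1)).filter
      fun js => (G.slotBlock i js).Nonempty).image (G.slotBlock i) := by
    ext B
    simp only [mem_kerBlocks_iff, Finset.mem_image, Finset.mem_filter, Finset.mem_product,
      Finset.mem_univ, true_and, Finset.mem_range]
    constructor
    · rintro ⟨k, rfl⟩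
      refine ⟨_, ⟨Nat.lt_succ_of_le (countAfter_le _ k), k, ?_⟩, G.slotBlock_eq i k⟩
      simp [slotBlock]
    · rintro ⟨js, ⟨_, k, hk⟩, rfl⟩
      rw [G.eq_of_mem_slotBlock i hk]
      exact ⟨k, (G.slotBlock_eq i k).symm⟩
  rw [himage, Finset.prod_image]
  · refine Finset.prod_filter_of_ne fun js _ h => ?_
    rw [Finset.nonempty_iff_ne_empty]
    intro he
    exact h (by rw [he, hf])
  · rintro js hjs js' _ he
    obtain ⟨k, hk⟩ := (Finset.mem_filter.1 hjs).2
    have hk' : k ∈ G.slotBlock i js' := he ▸ hk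
    rw [G.eq_of_mem_slotBlock i hk, G.eq_of_mem_slotBlock i hk']

end Digraph

/-! ### Factorization of the state over slots. -/

namespace HilbertTensor

variable {ι : Type*} [Fintype ι] {H : ι → Type*} [∀ i, NormedAddCommGroup (H i)]
  [∀ i, InnerProductSpace ℂ (H i)]

/-- `A ↦ A_1 ⊗ ⋯ ⊗ A_N` as a monoid homomorphism. -/
noncomputable def opHom : (∀ i, H i →L[ℂ] H i) →* (HilbertTensor H →L[ℂ] HilbertTensor H) where
  toFun := op
  map_one' := ext_tprod fun x => by simp
  map_mul' := op_mul

lemma inner_orderedProd_op (ξ : ∀ i, H i) {m : ℕ} (b : Fin m → ∀ i, H i →L[ℂ] H i)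
    (U : Finset (Fin m)) :
    ⟪tprod ξ, orderedProd (fun k => op (b k)) U (tprod ξ)⟫_ℂ =
      ∏ j, ⟪ξ j, orderedProd (fun k => b k j) U (ξ j)⟫_ℂ := by
  have h : orderedProd (fun k => op (b k)) U = op (orderedProd b U) :=
    (map_orderedProd opHom b U).symm
  rw [h, op_tprod, inner_tprod]
  refine Finset.prod_congr rfl fun j _ => ?_
  exact congrArg (fun T : H j →L[ℂ] H j => ⟪ξ j, T (ξ j)⟫_ℂ)
    (map_orderedProd (Pi.evalMonoidHom (fun i => H i →L[ℂ] H i) j) b U)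

end HilbertTensor

end BlockFactorization

/-! ### BMT independence of the representations. -/

theorem mainTheorem2 (N : ℕ) (H : Fin N → Type*) [∀ i, NormedAddCommGroup (H i)]
    [∀ i, InnerProductSpace ℂ (H i)] [∀ i, CompleteSpace (H i)]
    (ξ : ∀ i, H i) (hξ : ∀ i, ‖ξ i‖ = 1) (G : Digraph (Fin N)) :
    BMTIndependent
      (vectorState (HilbertTensor.tprod ξ) (HilbertTensor.norm_tprod_eq_one hξ)) G
      (fun i => (NonUnitalStarAlgHom.range (bmtRep G ξ hξ i)).toNonUnitalSubalgebra) := by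
  intro m _ i a ha
  choose A hA using ha
  set b : Fin m → ∀ j, H j →L[ℂ] H j :=
    fun k => Function.update (slotOperator G ξ (i k)) (i k) (A k) with hb
  obtain rfl : a = fun k => HilbertTensor.op (b k) := by
    classical
    funext k
    rw [← hA k]
    change slotTensor G ξ (i k) (A k) = _
    rw [slotTensor]
    -- Both sides are the same update, up to the choice of decidable equality on `Fin N`.
    congr!
  have hne : ∀ k j, i k ≠ j → b k j = slotOperator G ξ (i k) j := fun k j h => by
    simp [hb, Function.update_of_ne h.symm]
  have hφ : ∀ U, (vectorState (HilbertTensor.tprod ξ) (HilbertTensor.norm_tprod_eq_one hξ)).φ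
      (orderedProd (fun k => HilbertTensor.op (b k)) U) =
      ∏ j, ⟪ξ j, orderedProd (fun k => b k j) U (ξ j)⟫_ℂ :=
    fun U => HilbertTensor.inner_orderedProd_op ξ b U
  have hξξ : ∀ j, ⟪ξ j, ξ j⟫_ℂ = 1 := fun j => by
    rw [inner_self_eq_norm_sq_to_K, hξ j]
    simp
  rw [← orderedProd_univ, hφ, G.prod_kerBlocks i _ (by
    rw [orderedProd_empty, NCProbSpace.map_one])]
  refine Finset.prod_congr rfl fun j _ => ?_
  rw [inner_orderedProd_eq_prod (ξ j) (hξ j) (fun k => b k j) (G.Separates i j) (fun k => i k = j)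
    (fun k hk => by rw [hne k j hk.1, slotOperator, if_neg hk.2]) (fun k hk h => h.1 hk)
    (fun k hk hkj => by
      rw [hne k j hkj, slotOperator, if_pos (not_not.1 fun h => hk ⟨hkj, h⟩)])]
  refine Finset.prod_congr rfl fun s _ => ?_
  -- The state of a block with letter `j` is again a product over slots, of which only slot `j` can
  -- differ from 1.
  rw [hφ, Finset.prod_eq_single j _ (by simp)]
  · rfl
  · intro j' _ hj
    rw [orderedProd_apply_eq_self _ _ _ fun k hk => ?_, hξξ]
    have hk' : i k = j := (congrArg Prod.fst (G.eq_of_mem_slotBlock i hk)).symm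
    rw [hne k j' (hk' ▸ hj.symm), slotOperator]
    split_ifs
    · simp
    · rw [InnerProductSpace.rankOne_apply, hξξ, one_smul]
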